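/- Fix a nontrivial ring $A$ with unit; all simplicial chains have coefficients in $A$. For a metric space $(X,d)$ and $r>0$ the Rips complex $P_r(X)$ is the simplicial complex with vertex set $X$ in which a nonempty finite set spans a simplex if and only if its points are pairwise at distance at most $r$. A $1$-spherical cycle in a simplicial complex $K$ is a simplicial map $f\colon S^1\to K$ from an oriented simplicial $1$-sphere (an oriented $n$-gon, $n\ge 3$); $C_f$ denotes the image under $f$ of the fundamental $1$-cycle of the polygon and $\mathrm{supp}(f)$ the image of its vertex set. A filling of $f$ in a complex $L$ is a simplicial $2$-chain $D$ of $L$ with $\partial D=C_f$, and $f$ is null-homologous in $L$ if it has a filling in $L$; $\mathrm{supp}(D)$ denotes the set of vertices of all simplices underlying $D$. The space $X$ is $S^1FRC$ if for every $r>0$ there is $R\ge r$ such that every $1$-spherical cycle $f$ in $P_r(X)$ that is null-homologous in $P_r(X)$ has a filling $D$ in $P_R(X)$ with $\mathrm{supp}(D)\subseteq\mathrm{supp}(f)$. A graph is simplicial (no loops or multiple edges) and is regarded as the metric space consisting of its vertex set $X^{(0)}$, with $d(u,v)$ the minimal number of edges of an edge path from $u$ to $v$. A map $f\colon X\to Y$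 of metric spaces is a quasi-isometric embedding if there are $a>0$, $c\ge 0$ and $b,e\in\mathbb R$ with $a\,d(x,x')+b\le d(f(x),f(x'))\le c\,d(x,x')+e$ for all $x,x'\in X$. The spaces $X$ and $Y$ are quasi-isometric if there are quasi-isometric embeddings $f\colon X\to Y$ and $g\colon Y\to X$ such that $g\circ f$ and $f\circ g$ are at bounded distance from the identity maps. **Proposition.** Let $X$ be a (nonempty) connected graph which is $S^1FRC$, and assume that there exists $r>0$ such that every $1$-spherical cycle in $P_1(X^{(0)})$ is null-homologous in $P_r(X^{(0)})$. Then $X$ is quasi-isometric to a simplicial tree. -/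

import Mathlib

namespace FillingRadius

/-! ### Rips complexes -/

/-- The Rips complex `P_r(X)` of a metric space: a nonempty finite set of points spans a simplex
iff all its pairwise distances are at most `r`. (For `r ≥ 0` every point is a vertex.) -/
def ripsComplex (X : Type*) [MetricSpace X] (r : ℝ) : PreAbstractSimplicialComplex X where
  faces := {s | s.Nonempty ∧ ∀ x ∈ s, ∀ y ∈ s, dist x y ≤ r}
  isRelLowerSet_faces := fun _ hs =>
    ⟨hs.1, fun _ hts ht => ⟨ht, fun x hx y hy => hs.2 x (hts hx) y (hts hy)⟩⟩

/-! ### Oriented simplicial chains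

The group of oriented simplicial `k`-chains of a complex `K` with coefficients in `A` is realised
as the group of finitely supported alternating functions on ordered `k`-simplices of `K`. -/

/-- The simplicial `k`-chains of `K` with coefficients in `A`: finitely supported functions `c` on
`(k+1)`-tuples of points, vanishing off the tuples that enumerate without repetition the vertices of
a simplex of `K`, and alternating, i.e. reversing the orientation of a simplex changes the sign. -/
def chains (A : Type*) [Ring A] {X : Type*} (K : PreAbstractSimplicialComplex X) (k : ℕ) :
    Submodule A ((Fin (k + 1) → X) →₀ A) where
  carrier := {c | (∀ t, c t ≠ 0 →
      Function.Injective t ∧ ∃ s ∈ K, (s : Set X) = Set.range t) ∧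
    ∀ (σ : Equiv.Perm (Fin (k + 1))) (t), c (t ∘ σ) = ((Equiv.Perm.sign σ : ℤ) : A) * c t}
  zero_mem' := by simp
  add_mem' := by
    rintro c d ⟨hc, hc'⟩ ⟨hd, hd'⟩
    refine ⟨fun t ht => ?_, fun σ t => by simp [hc', hd', mul_add]⟩
    by_cases h : c t = 0
    · exact hd t (by simpa [h] using ht)
    · exact hc t h
  smul_mem' := by
    rintro a c ⟨hc, hc'⟩
    refine ⟨fun t ht => hc t fun h => ht (by simp [h]), fun σ t => ?_⟩
    simp only [Finsupp.smul_apply, smul_eq_mul, hc', ← mul_assoc]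
    rw [(Int.cast_commute _ a).eq]

/-- The elementary chain `[x₀, …, x_k]`. It is zero if the `xᵢ` are not distinct. -/
noncomputable def orientedSimplex (A : Type*) [Ring A] {X : Type*} {k : ℕ}
    (t : Fin (k + 1) → X) : (Fin (k + 1) → X) →₀ A :=
  ∑ σ : Equiv.Perm (Fin (k + 1)), Finsupp.single (t ∘ σ) ((Equiv.Perm.sign σ : ℤ) : A)

/-- The simplicial boundary operator on `(k+1)`-chains (viewed as alternating functions):
`(∂ c)(x₀, …, x_k) = ∑_z c(z, x₀, …, x_k)`. On elementary chains this is the usual alternating sum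
of faces, see `boundary_orientedSimplex`. -/
noncomputable def boundary (A : Type*) [Ring A] {X : Type*} {k : ℕ} :
    ((Fin (k + 2) → X) →₀ A) →ₗ[A] ((Fin (k + 1) → X) →₀ A) :=
  Finsupp.lmapDomain A A (fun t => Fin.tail t)

/-- The set of vertices of all simplices underlying a chain. -/
def chainSupport {A : Type*} [Ring A] {X : Type*} {k : ℕ} (c : (Fin (k + 1) → X) →₀ A) : Set X :=
  {x | ∃ t, c t ≠ 0 ∧ x ∈ Set.range t}

theorem boundary_orientedSimplex (A : Type*) [Ring A] {X : Type*} {k : ℕ}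
    (t : Fin (k + 2) → X) :
    boundary A (orientedSimplex A t) =
      ∑ i : Fin (k + 2), (-1 : A) ^ (i : ℕ) • orientedSimplex A (t ∘ i.succAbove) := by
  unfold boundary orientedSimplex
  rw [map_sum, ← Equiv.Perm.decomposeFin.symm.sum_comp, Fintype.sum_prod_type]
  refine Finset.sum_congr rfl fun i _ => ?_
  rw [Finset.smul_sum]
  refine Fin.cases ?_ (fun i => ?_) i
  · refine Finset.sum_congr rfl fun e _ => ?_
    have h : Fin.tail (t ∘ Equiv.Perm.decomposeFin.symm (0, e)) =
        (t ∘ (0 : Fin (k + 2)).succAbove) ∘ e := by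
      funext j
      simp [Fin.tail]
    simp [Finsupp.lmapDomain_apply, Finsupp.mapDomain_single, h, Equiv.Perm.decomposeFin.symm_sign]
  · refine Fintype.sum_equiv (Equiv.mulLeft i.cycleRange) _ _ fun e => ?_
    have h : Fin.tail (t ∘ Equiv.Perm.decomposeFin.symm (i.succ, e)) =
        (t ∘ i.succ.succAbove) ∘ (Equiv.mulLeft i.cycleRange e) := by
      funext j
      simp [Fin.tail, Fin.succAbove_cycleRange]
    have hs : (-1 : A) ^ ((i : ℕ) + 1) * (-1) ^ (i : ℕ) = -1 := by
      rw [pow_succ', mul_assoc, ← pow_add, Even.neg_one_pow ⟨_, rfl⟩, mul_one]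
    rw [Finsupp.lmapDomain_apply, Finsupp.mapDomain_single, h, Finsupp.smul_single]
    congr 1
    simp [Equiv.Perm.decomposeFin.symm_sign, Fin.sign_cycleRange, ← mul_assoc, hs]

/-! ### Spherical 1-cycles and fillings -/

/-- A `1`-spherical cycle in `K`: a simplicial map to `K` from an oriented simplicial `1`-sphere,
i.e. from the `n`-gon, `n = m + 3 ≥ 3`, with vertices `0, 1, …, n - 1` and oriented edges
`(i, i + 1)`, indices being taken modulo `n`. -/
structure SphericalOneCycle {X : Type*} (K : PreAbstractSimplicialComplex X) where
  m : ℕ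
  vertex : Fin (m + 3) → X
  simplicial : ∀ i, ∃ s ∈ K, (s : Set X) = {vertex i, vertex (i + 1)}

namespace SphericalOneCycle

variable {X : Type*} {K : PreAbstractSimplicialComplex X}

/-- The image `C_f` of the fundamental cycle of the polygon. -/
noncomputable def chain (A : Type*) [Ring A] (f : SphericalOneCycle K) : (Fin 2 → X) →₀ A :=
  ∑ i, orientedSimplex A ![f.vertex i, f.vertex (i + 1)]

/-- The image of the vertex set of the polygon. -/
def support (f : SphericalOneCycle K) : Set X := Set.range f.vertex

/-- `D` is a filling of `f` in the complex `L`: a simplicial `2`-chain of `L` with `∂D = C_f`. -/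
def IsFilling (A : Type*) [Ring A] (f : SphericalOneCycle K) (L : PreAbstractSimplicialComplex X)
    (D : (Fin 3 → X) →₀ A) : Prop :=
  D ∈ chains A L 2 ∧ boundary A D = f.chain A

/-- `f` is null-homologous in the complex `L`. -/
def NullHomologous (A : Type*) [Ring A] (f : SphericalOneCycle K)
    (L : PreAbstractSimplicialComplex X) : Prop :=
  ∃ D, f.IsFilling A L D

end SphericalOneCycle

/-- The metric space `X` is `S¹FRC` (has filling radius for `1`-spherical cycles constant), with
respect to coefficients in `A`. -/
def IsS1FRC (A : Type*) [Ring A] (X : Type*) [MetricSpace X] : Prop :=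
  ∀ r : ℝ, 0 < r → ∃ R : ℝ, r ≤ R ∧
    ∀ f : SphericalOneCycle (ripsComplex X r), f.NullHomologous A (ripsComplex X r) →
      ∃ D, f.IsFilling A (ripsComplex X R) D ∧ chainSupport D ⊆ f.support

/-! ### Quasi-isometries -/

section QuasiIsometry

variable {X Y : Type*} [MetricSpace X] [MetricSpace Y]

/-- `ρ₁(d(x₁, x₂)) ≤ d(f x₁, f x₂) ≤ ρ₂(d(x₁, x₂))` for non-decreasing affine functions
`ρ₁(t) = a * t + b` with limit `+∞` at `+∞`, and `ρ₂(t) = c * t + d`. -/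
def IsQuasiIsometricEmbedding (f : X → Y) : Prop :=
  ∃ a b c d : ℝ, 0 < a ∧ 0 ≤ c ∧ ∀ x₁ x₂ : X,
    a * dist x₁ x₂ + b ≤ dist (f x₁) (f x₂) ∧ dist (f x₁) (f x₂) ≤ c * dist x₁ x₂ + d

/-- Two maps are close if they are at bounded distance from each other. -/
def Close (f g : X → Y) : Prop :=
  ∃ R : ℝ, 0 ≤ R ∧ ∀ x, dist (f x) (g x) ≤ R

variable (X Y) in
/-- `X` and `Y` are quasi-isometric. -/
def QuasiIsometric : Prop :=
  ∃ (f : X → Y) (g : Y → X), IsQuasiIsometricEmbedding f ∧ IsQuasiIsometricEmbedding g ∧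
    Close (g ∘ f) id ∧ Close (f ∘ g) id

end QuasiIsometry

/-! ### Graphs as metric spaces -/

/-- The vertex set of a connected graph, where the distance of two vertices is the minimal number
of edges of an edge path joining them. -/
@[reducible]
noncomputable def graphMetric {V : Type*} (G : SimpleGraph V) (hG : G.Connected) :
    MetricSpace V where
  dist u v := (G.dist u v : ℝ)
  dist_self u := by simp
  dist_comm u v := by rw [SimpleGraph.dist_comm]
  dist_triangle u v w := by exact_mod_cast hG.dist_triangle
  eq_of_dist_eq_zero := fun {u v} h => hG.dist_eq_zero_iff.mp (by exact_mod_cast h)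

end FillingRadius

open FillingRadius

universe u v

/-! The hypotheses give one `R` such that every closed walk bounds a 2-chain supported on its own
vertices, with simplices of diameter at most `R`. This forces a bottleneck
(`HasWalkFillings.exists_dist_le`): a walk joining the ends of a geodesic from `o` comes within `2 *
R` of each of its vertices, since otherwise a cut of the geodesic would pair to 1 with a boundary.
Identify vertices at equal distance `n` from `o` that are joined by a walk never closer to `o` than
`n`. The bottleneck bounds the diameter of the classes (`dist_le_of_outerSetoid`), and stepping
towards `o` makes the classes a rooted tree. The quotient map and any section of it are the
quasi-isometries. -/

namespace FillingRadius

/-! ### Trees from parent maps -/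

/-- The graph joining every point to its image under `parent`. -/
def parentGraph {W : Type*} (parent : W → W) : SimpleGraph W :=
  SimpleGraph.fromRel fun a b => parent a = b

theorem parentGraph_adj {W : Type*} {parent : W → W} {a b : W} :
    (parentGraph parent).Adj a b ↔ a ≠ b ∧ (parent a = b ∨ parent b = a) :=
  SimpleGraph.fromRel_adj _ _ _

/-- Iterating `parent` lowers `level` until the root is reached, so the graph is connected. It is
acyclic because every edge is a bridge: the edge from `a` to its parent is the only one leaving the
set of descendants of `a`. -/
theorem parentGraph_isTree {W : Type*} {parent : W → W} {level : W → ℕ} {root : W}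
    (hlevel : ∀ a, level a ≠ 0 → level (parent a) + 1 = level a)
    (hroot : ∀ a, level a = 0 → a = root) (hparent : parent root = root) :
    (parentGraph parent).IsTree := by
  have hreach : ∀ n a, level a = n → (parentGraph parent).Reachable a root := by
    intro n
    induction n with
    | zero => intro a ha; rw [hroot a ha]
    | succ n ih =>
      intro a ha
      have h := hlevel a (by omega)
      have hadj : (parentGraph parent).Adj a (parent a) := by
        rw [parentGraph_adj]
        refine ⟨fun h' => ?_, Or.inl rfl⟩
        rw [← h'] at h
        omega
      exact hadj.reachable.trans (ih _ (by omega))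
  have : Nonempty W := ⟨root⟩
  refine ⟨⟨fun a b => (hreach _ a rfl).trans (hreach _ b rfl).symm⟩, ?_⟩
  rw [SimpleGraph.isAcyclic_iff_forall_adj_isBridge]
  have key : ∀ a, a ≠ parent a → (parentGraph parent).IsBridge s(a, parent a) := by
    intro a hne
    have ha : level a ≠ 0 := fun h => hne (by rw [hroot a h, hparent])
    have hle : ∀ k x, level (parent^[k] x) ≤ level x := by
      intro k
      induction k with
      | zero => simp
      | succ k ih =>
        intro x
        rw [Function.iterate_succ_apply]
        refine (ih _).trans ?_
        by_cases hx : level x = 0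
        · rw [hroot x hx, hparent]
        · have := hlevel x hx
          omega
    rw [SimpleGraph.isBridge_iff]
    rintro ⟨w⟩
    -- With that edge deleted, walks preserve being a descendant of `a`; `parent a` is not one, its
    -- level being too low.
    have hinv : ∀ {x y} (_ : ((parentGraph parent).deleteEdges {s(a, parent a)}).Walk x y),
        (∃ k, parent^[k] x = a) → ∃ k, parent^[k] y = a := by
      intro x y w
      induction w with
      | nil => exact id
      | @cons x y z hxy _ ih =>
        rintro ⟨k, hk⟩
        refine ih ?_
        rw [SimpleGraph.deleteEdges_adj, parentGraph_adj] at hxy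
        obtain ⟨⟨hxy, h | h⟩, hdel⟩ := hxy
        · cases k with
          | zero =>
            rw [Function.iterate_zero, id] at hk
            subst hk
            exact (hdel (by simp [h])).elim
          | succ k => exact ⟨k, by rw [← hk, Function.iterate_succ_apply, h]⟩
        · exact ⟨k + 1, by rw [Function.iterate_succ_apply, h, hk]⟩
    obtain ⟨k, hk⟩ := hinv w ⟨0, rfl⟩
    have h₁ := hle k (parent a)
    have h₂ := hlevel a ha
    rw [hk] at h₁
    omega
  intro a b hab
  rw [parentGraph_adj] at hab
  obtain ⟨hne, rfl | rfl⟩ := hab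
  · exact key a hne
  · rw [Sym2.eq_swap]
    exact key b hne.symm

/-! ### Pairing boundaries with cuts -/

section Cut

variable {A : Type*} [Ring A] {X : Type*}

/-- The cochain which counts the ordered pairs leading from `S` to `T`. -/
noncomputable def cut (A : Type*) [Ring A] (S T : Set X) : ((Fin 2 → X) →₀ A) →ₗ[A] A :=
  Finsupp.lsum ℕ fun t =>
    open scoped Classical in if t 0 ∈ S ∧ t 1 ∈ T then LinearMap.id else 0

open scoped Classical in
theorem cut_single (S T : Set X) (t : Fin 2 → X) (a : A) :
    cut A S T (Finsupp.single t a) = if t 0 ∈ S ∧ t 1 ∈ T then a else 0 := by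
  rw [cut, Finsupp.lsum_single]
  split_ifs <;> simp

open scoped Classical in
theorem cut_orientedSimplex (S T : Set X) (u v : X) :
    cut A S T (orientedSimplex A ![u, v]) =
      (if u ∈ S ∧ v ∈ T then 1 else 0) - if v ∈ S ∧ u ∈ T then 1 else 0 := by
  have h : (Finset.univ : Finset (Equiv.Perm (Fin 2))) = {1, Equiv.swap 0 1} := by decide
  rw [orientedSimplex, h, Finset.sum_pair (by decide), map_add, cut_single, cut_single]
  simp only [Equiv.Perm.sign_one, Equiv.Perm.sign_swap (show (0 : Fin 2) ≠ 1 by decide)]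
  simp only [Function.comp_apply, Equiv.swap_apply_left, Equiv.swap_apply_right,
    Equiv.Perm.one_apply]
  simp only [Matrix.cons_val_zero, Matrix.cons_val_one]
  by_cases h₁ : u ∈ S ∧ v ∈ T <;> by_cases h₂ : v ∈ S ∧ u ∈ T <;>
    simp [h₁, h₂, sub_eq_add_neg]

/-- The pairing sums `D` over ordered triangles with `t 1 ∈ S` and `t 2 ∈ T`. Swapping `t 0` with
the vertex on its own side pairs them off with opposite signs. Injectivity of `t` excludes fixed
points, so characteristic 2 causes no trouble. -/
theorem cut_boundary_eq_zero {K : PreAbstractSimplicialComplex X} {D : (Fin 3 → X) →₀ A}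
    (hD : D ∈ chains A K 2) {S T : Set X} (hST : Disjoint S T)
    (h : ∀ t, D t ≠ 0 → t 1 ∈ S → t 2 ∈ T → t 0 ∈ S ∪ T) :
    cut A S T (boundary A D) = 0 := by
  classical
  have hsum : cut A S T (boundary A D) =
      ∑ t ∈ D.support.filter (fun t => t 1 ∈ S ∧ t 2 ∈ T), D t := by
    rw [boundary, Finsupp.lmapDomain_apply, Finsupp.mapDomain, Finsupp.sum, map_sum,
      Finset.sum_filter]
    exact Finset.sum_congr rfl fun t _ => cut_single _ _ _ _
  obtain ⟨hinj, halt⟩ := hD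
  have hswap : ∀ {i j : Fin 3} (_ : i ≠ j) t, D (t ∘ Equiv.swap i j) = -D t := by
    intro i j hij t
    rw [halt, Equiv.Perm.sign_swap hij]
    simp
  have hdisj : ∀ {x}, x ∈ T → x ∉ S := fun hT hS => Set.disjoint_left.mp hST hS hT
  have hne : ∀ {i j : Fin 3} (_ : i ≠ j) t, D t ≠ 0 → t ∘ Equiv.swap i j ≠ t := by
    intro i j hij t ht he
    have := congrFun he i
    rw [Function.comp_apply, Equiv.swap_apply_left] at this
    exact hij ((hinj t ht).1 this).symm
  have h01 : (0 : Fin 3) ≠ 1 := by decide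
  have h02 : (0 : Fin 3) ≠ 2 := by decide
  have h12 : Equiv.swap (0 : Fin 3) 1 2 = 2 := by decide
  have h21 : Equiv.swap (0 : Fin 3) 2 1 = 1 := by decide
  rw [hsum]
  refine Finset.sum_involution
    (fun t _ => if t 0 ∈ S then t ∘ Equiv.swap 0 1 else t ∘ Equiv.swap 0 2) ?_ ?_ ?_ ?_
  · intro t _
    split_ifs
    · rw [hswap h01, add_neg_cancel]
    · rw [hswap h02, add_neg_cancel]
  · intro t _ ht
    split_ifs
    · exact hne h01 t ht
    · exact hne h02 t ht
  · intro t ht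
    rw [Finset.mem_filter, Finsupp.mem_support_iff] at ht
    obtain ⟨ht, h1, h2⟩ := ht
    rw [Finset.mem_filter, Finsupp.mem_support_iff]
    split_ifs with h0
    · rw [hswap h01]
      simp [ht, h0, h2, h12]
    · have h0' := (h t ht h1 h2).resolve_left h0
      rw [hswap h02]
      simp [ht, h1, h0', h21]
  · intro t ht
    rw [Finset.mem_filter, Finsupp.mem_support_iff] at ht
    obtain ⟨ht, h1, h2⟩ := ht
    by_cases h0 : t 0 ∈ S
    · simp [h0, h1, Function.comp_assoc, ← Equiv.coe_trans]
    · simp [h0, hdisj h2, Function.comp_assoc, ← Equiv.coe_trans]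

end Cut

/-! ### Closed walks as spherical cycles -/

section Walks

variable {V : Type*} {G : SimpleGraph V}

theorem dist_getVert_succ_le {u v : V} (w : G.Walk u v) (i : ℕ) :
    G.dist (w.getVert i) (w.getVert (i + 1)) ≤ 1 := by
  by_cases h : i < w.length
  · exact (SimpleGraph.dist_eq_one_iff_adj.mpr (w.adj_getVert_succ h)).le
  · rw [w.getVert_of_length_le (by omega), w.getVert_of_length_le (by omega)]
    simp

theorem dist_getVert_le (hG : G.Connected) {u v : V} (w : G.Walk u v) (i j : ℕ) :
    G.dist (w.getVert i) (w.getVert (i + j)) ≤ j := by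
  induction j with
  | zero => simp
  | succ j ih =>
    have h₁ := dist_getVert_succ_le w (i + j)
    have h₂ := hG.dist_triangle (u := w.getVert i) (v := w.getVert (i + j))
      (w := w.getVert (i + j + 1))
    rw [← add_assoc]
    omega

theorem dist_getVert_of_length_eq_dist (hG : G.Connected) {u v : V} {w : G.Walk u v}
    (hw : w.length = G.dist u v) {i : ℕ} (hi : i ≤ w.length) : G.dist u (w.getVert i) = i := by
  have h₁ := dist_getVert_le hG w 0 i
  have h₂ := dist_getVert_le hG w i (w.length - i)
  have h₃ := hG.dist_triangle (u := u) (v := w.getVert i) (w := v)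
  rw [Nat.add_sub_cancel' hi, SimpleGraph.Walk.getVert_length] at h₂
  rw [zero_add, SimpleGraph.Walk.getVert_zero] at h₁
  omega

theorem getVert_val_add_one {o : V} (w : G.Walk o o) (i : Fin (w.length + 3)) :
    w.getVert ((i + 1 : Fin (w.length + 3)) : ℕ) = w.getVert (i + 1) := by
  rw [Fin.val_add_one]
  split_ifs with h
  · subst h
    rw [SimpleGraph.Walk.getVert_zero, w.getVert_of_length_le]
    simp only [Fin.val_last]
    omega
  · rfl

/-- The spherical cycle running once around a closed walk and then resting. -/
def closedWalkCycle (hG : G.Connected) {o : V} (w : G.Walk o o) :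
    letI := graphMetric G hG
    SphericalOneCycle (ripsComplex V 1) :=
  letI := graphMetric G hG
  -- The polygon needs three vertices even for a trivial walk. `getVert` is constant past the end,
  -- so the extra edges are degenerate and contribute zero.
  { m := w.length
    vertex := fun i => w.getVert i
    simplicial := by
      classical
      intro i
      have hi := getVert_val_add_one w i
      refine ⟨{w.getVert i, w.getVert (i + 1)}, ⟨by simp, ?_⟩, by simp [hi]⟩
      have h : (G.dist (w.getVert i) (w.getVert (i + 1)) : ℝ) ≤ 1 := by
        exact_mod_cast dist_getVert_succ_le w i
      have h' : (G.dist (w.getVert (i + 1)) (w.getVert i) : ℝ) ≤ 1 := by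
        rwa [SimpleGraph.dist_comm]
      intro x hx y hy
      simp only [Finset.mem_insert, Finset.mem_singleton] at hx hy
      change (G.dist x y : ℝ) ≤ 1
      rcases hx with rfl | rfl <;> rcases hy with rfl | rfl <;> simp [h, h'] }

theorem closedWalkCycle_support (hG : G.Connected) {o : V} (w : G.Walk o o) :
    letI := graphMetric G hG
    (closedWalkCycle hG w).support ⊆ {x | x ∈ w.support} := by
  rintro _ ⟨i, rfl⟩
  exact w.getVert_mem_support _

theorem closedWalkCycle_chain (A : Type*) [Ring A] (hG : G.Connected) {o : V} (w : G.Walk o o) :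
    letI := graphMetric G hG
    (closedWalkCycle hG w).chain A =
      ∑ i ∈ Finset.range (w.length + 3),
        orientedSimplex A ![w.getVert i, w.getVert (i + 1)] := by
  rw [Finset.sum_range]
  refine Finset.sum_congr rfl fun (i : Fin (w.length + 3)) _ => ?_
  rw [← getVert_val_add_one w i]
  rfl

/-- Every closed walk bounds a chain of simplices of diameter at most `R` supported on the walk. -/
def HasWalkFillings (A : Type*) [Ring A] (G : SimpleGraph V) (R : ℕ) : Prop :=
  ∀ (o : V) (w : G.Walk o o), ∃ (K : PreAbstractSimplicialComplex V) (D : (Fin 3 → V) →₀ A),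
    D ∈ chains A K 2 ∧
    boundary A D = ∑ i ∈ Finset.range (w.length + 3),
      orientedSimplex A ![w.getVert i, w.getVert (i + 1)] ∧
    ∀ t, D t ≠ 0 → ∀ i, t i ∈ w.support ∧ ∀ j, G.dist (t i) (t j) ≤ R

theorem chains_mono (A : Type*) [Ring A] {K L : PreAbstractSimplicialComplex V} {k : ℕ}
    (h : ∀ s ∈ K, s ∈ L) : chains A K k ≤ chains A L k := fun _ hc =>
  ⟨fun t ht => ⟨(hc.1 t ht).1, (hc.1 t ht).2.imp fun s hs => ⟨h s hs.1, hs.2⟩⟩, hc.2⟩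

theorem ripsComplex_mono {X : Type*} [MetricSpace X] {r r' : ℝ} (h : r ≤ r') :
    ∀ s ∈ ripsComplex X r, s ∈ ripsComplex X r' := fun _ hs =>
  ⟨hs.1, fun x hx y hy => (hs.2 x hx y hy).trans h⟩

theorem exists_hasWalkFillings {A : Type*} [Ring A] (hG : G.Connected)
    (hFRC : letI := graphMetric G hG; IsS1FRC A V)
    (hcyc : letI := graphMetric G hG
      ∃ r : ℝ, 0 < r ∧
        ∀ f : SphericalOneCycle (ripsComplex V 1), f.NullHomologous A (ripsComplex V r)) :
    ∃ R, 1 ≤ R ∧ HasWalkFillings A G R := by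
  let := graphMetric G hG
  obtain ⟨r, hr, hcyc⟩ := hcyc
  -- The scale `max r 1` accommodates both the cycle, which lives at scale 1, and its filling at
  -- scale `r`.
  obtain ⟨R, hrR, hR⟩ := hFRC (max r 1) (by positivity)
  refine ⟨⌈R⌉₊, Nat.one_le_ceil_iff.mpr (by linarith [le_max_right r 1]), fun o w => ?_⟩
  let f := closedWalkCycle hG w
  let f' : SphericalOneCycle (ripsComplex V (max r 1)) :=
    { m := f.m
      vertex := f.vertex
      simplicial := fun i => (f.simplicial i).imp fun s hs =>
        ⟨ripsComplex_mono (le_max_right _ _) s hs.1, hs.2⟩ }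
  obtain ⟨D₀, hD₀, hD₀'⟩ := hcyc f
  obtain ⟨D, ⟨hD, hD'⟩, hsupp⟩ := hR f'
    ⟨D₀, chains_mono A (ripsComplex_mono (le_max_left _ _)) hD₀, hD₀'⟩
  refine ⟨_, D, hD, hD'.trans (closedWalkCycle_chain A hG w), fun t ht i => ⟨?_, fun j => ?_⟩⟩
  · exact closedWalkCycle_support hG w (hsupp ⟨t, ht, i, rfl⟩)
  · obtain ⟨-, s, hs, hst⟩ := hD.1 t ht
    have hmem : ∀ i, t i ∈ s := fun i => by
      rw [← Finset.mem_coe, hst]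
      exact ⟨i, rfl⟩
    have h : (G.dist (t i) (t j) : ℝ) ≤ R := hs.2 _ (hmem i) _ (hmem j)
    exact_mod_cast h.trans (Nat.le_ceil R)

end Walks

/-! ### The bottleneck property -/

section Bottleneck

variable {V : Type*} {G : SimpleGraph V}

/-- If `β` avoids the `2 * R`-ball about `p`, then inside that ball the closed walk `γ.append β` is
only the geodesic, which crosses from level `k` to level `k + 1` exactly once. -/
theorem HasWalkFillings.exists_dist_le {A : Type*} [Ring A] [Nontrivial A] {R : ℕ}
    (hR : HasWalkFillings A G R) (hR1 : 1 ≤ R) (hG : G.Connected) {o v : V} {γ : G.Walk o v}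
    (hγ : γ.length = G.dist o v) {k : ℕ} (hk : k < γ.length) (β : G.Walk v o) :
    ∃ q ∈ β.support, G.dist q (γ.getVert k) ≤ 2 * R := by
  classical
  by_contra! hβ
  set p := γ.getVert k with hp
  have hlev : ∀ i ≤ γ.length, G.dist o (γ.getVert i) = i := fun i hi =>
    dist_getVert_of_length_eq_dist hG hγ hi
  let S : Set V := {x | x ∈ γ.support ∧ G.dist x p ≤ 2 * R ∧ G.dist o x ≤ k}
  let T : Set V := {x | x ∈ γ.support ∧ G.dist x p ≤ 2 * R ∧ k < G.dist o x}
  have hST : Disjoint S T := Set.disjoint_left.mpr fun x hS hT => absurd hS.2.2 hT.2.2.not_ge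
  obtain ⟨K, D, hD, hbd, hsupp⟩ := hR o (γ.append β)
  have hzero : cut A S T (boundary A D) = 0 := by
    -- A triangle meeting both sides has its `S`-vertex at level above `k - R`, hence less than `R`
    -- from `p`. Its third vertex is then within `2 * R` of `p`, so it lies on `γ` and in `S ∪ T`.
    refine cut_boundary_eq_zero hD hST fun t ht h1 h2 => ?_
    obtain ⟨i, hi, hin⟩ := SimpleGraph.Walk.mem_support_iff_exists_getVert.mp h1.1
    have hdi := hlev i hin
    rw [hi] at hdi
    have hik : i ≤ k := by have := h1.2.2; omega
    have h₁ : G.dist (t 1) p ≤ k - i := by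
      have := dist_getVert_le hG γ i (k - i)
      rwa [Nat.add_sub_cancel' hik, hi] at this
    have h₂ := hG.dist_triangle (u := o) (v := t 1) (w := t 2)
    have h₃ := (hsupp t ht 1).2 2
    have h₄ := h2.2.2
    have h₅ := (hsupp t ht 0).2 1
    have h₆ := hG.dist_triangle (u := t 0) (v := t 1) (w := p)
    have h₇ : G.dist (t 0) p ≤ 2 * R := by omega
    have h₈ := (SimpleGraph.Walk.mem_support_append_iff _ _).mp (hsupp t ht 0).1
    have h₉ : t 0 ∈ γ.support := h₈.resolve_right fun h => absurd h₇ (hβ _ h).not_ge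
    rcases le_or_gt (G.dist o (t 0)) k with h | h
    · exact Or.inl ⟨h₉, h₇, h⟩
    · exact Or.inr ⟨h₉, h₇, h⟩
  rw [hbd, map_sum, Finset.sum_eq_single k] at hzero
  · rw [cut_orientedSimplex, SimpleGraph.Walk.getVert_append, SimpleGraph.Walk.getVert_append,
      if_pos hk] at hzero
    have hk1 : (if k + 1 < γ.length then γ.getVert (k + 1)
        else β.getVert (k + 1 - γ.length)) = γ.getVert (k + 1) := by
      split_ifs with h
      · rfl
      · have : k + 1 = γ.length := by omega
        simp [this]
    rw [hk1, if_pos, if_neg, sub_zero] at hzero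
    · exact one_ne_zero hzero
    · rintro ⟨h, -⟩
      have := h.2.2
      rw [hlev _ hk] at this
      omega
    · refine ⟨⟨γ.getVert_mem_support _, by simp [hp], (hlev k hk.le).le⟩,
        γ.getVert_mem_support _, ?_, by rw [hlev _ hk]; omega⟩
      have := dist_getVert_succ_le γ k
      rw [SimpleGraph.dist_comm, ← hp] at this
      omega
  · intro i _ hik
    rw [cut_orientedSimplex]
    -- Other edges of `γ` do not cross level `k`; edges of `β`, and the resting ones, stay outside
    -- the ball.
    by_cases hi : i < γ.length
    · have h₁ : (γ.append β).getVert i = γ.getVert i := by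
        rw [SimpleGraph.Walk.getVert_append, if_pos hi]
      have h₂ : (γ.append β).getVert (i + 1) = γ.getVert (i + 1) := by
        rw [SimpleGraph.Walk.getVert_append]
        split_ifs with h
        · rfl
        · have : i + 1 = γ.length := by omega
          simp [this]
      have h₃ := hlev i hi.le
      have h₄ := hlev (i + 1) hi
      rw [h₁, h₂, if_neg, if_neg, sub_zero]
      · rintro ⟨hS, hT⟩
        have h₅ := hS.2.2
        have h₆ := hT.2.2
        omega
      · rintro ⟨hS, hT⟩
        have h₅ := hS.2.2
        have h₆ := hT.2.2
        omega
    · have hmem : ∀ j, γ.length ≤ j → (γ.append β).getVert j ∈ β.support := by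
        intro j hj
        rw [SimpleGraph.Walk.getVert_append, if_neg hj.not_gt]
        exact β.getVert_mem_support _
      have h₁ := hβ _ (hmem i (by omega))
      have h₂ := hβ _ (hmem (i + 1) (by omega))
      rw [if_neg, if_neg, sub_zero]
      · exact fun h => absurd h.1.2.1 h₂.not_ge
      · exact fun h => absurd h.1.2.1 h₁.not_ge
  · intro h
    exact absurd (Finset.mem_range.mpr (by rw [SimpleGraph.Walk.length_append]; omega)) h

end Bottleneck

/-! ### The tree of outer components -/

section OuterComponents

variable {V : Type*} (G : SimpleGraph V) (o : V)

/-- Two vertices at the same distance `n` from `o` are equivalent if they can be joined by a walk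
which stays at distance at least `n` from `o`. -/
def outerSetoid : Setoid V where
  r v w := G.dist o v = G.dist o w ∧ ∃ β : G.Walk v w, ∀ x ∈ β.support, G.dist o v ≤ G.dist o x
  iseqv :=
    { refl := fun v => ⟨rfl, .nil, by simp⟩
      symm := by
        rintro v w ⟨h, β, hβ⟩
        exact ⟨h.symm, β.reverse, fun x hx => h ▸ hβ x (by simpa using hx)⟩
      trans := by
        rintro u v w ⟨h, β, hβ⟩ ⟨h', β', hβ'⟩
        refine ⟨h.trans h', β.append β', fun x hx => ?_⟩
        rcases (SimpleGraph.Walk.mem_support_append_iff _ _).mp hx with hx | hx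
        · exact hβ x hx
        · exact h ▸ hβ' x hx }

variable {G o}

theorem outerSetoid_of_adj {u v : V} (h : G.Adj u v) (hd : G.dist o u = G.dist o v) :
    outerSetoid G o u v :=
  ⟨hd, h.toWalk, by simp [hd]⟩

/-- This makes the parent of a class independent of the representative and of the lower neighbour
chosen. -/
theorem outerSetoid_of_adj_lower {u v u' v' : V} (h : outerSetoid G o u v) (hu : G.Adj u u')
    (hv : G.Adj v v') (hu' : G.dist o u' + 1 = G.dist o u) (hv' : G.dist o v' + 1 = G.dist o v) :
    outerSetoid G o u' v' := by
  obtain ⟨hd, β, hβ⟩ := h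
  refine ⟨by omega, .cons hu.symm (β.append hv.toWalk), fun x hx => ?_⟩
  rw [SimpleGraph.Walk.support_cons, List.mem_cons,
    SimpleGraph.Walk.mem_support_append_iff] at hx
  rcases hx with rfl | hx | hx
  · exact le_rfl
  · have := hβ x hx
    omega
  · simp only [SimpleGraph.Adj.toWalk, SimpleGraph.Walk.support_cons,
      SimpleGraph.Walk.support_nil, List.mem_cons, List.not_mem_nil, or_false] at hx
    rcases hx with rfl | rfl <;> omega

theorem exists_adj_lower (hG : G.Connected) {v : V} (hv : G.dist o v ≠ 0) :
    ∃ u, G.Adj v u ∧ G.dist o u + 1 = G.dist o v := by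
  obtain ⟨w, hw⟩ := hG.exists_walk_length_eq_dist o v
  refine ⟨w.getVert (w.length - 1), ?_, ?_⟩
  · have := w.adj_getVert_succ (i := w.length - 1) (by omega)
    rw [Nat.sub_add_cancel (by omega), SimpleGraph.Walk.getVert_length] at this
    exact this.symm
  · rw [dist_getVert_of_length_eq_dist hG hw (by omega)]
    omega

/-- Take `p` on a geodesic to `v`, `M + 1` steps before `v`. The bottleneck point `q` near `p` is
too low to lie on `β`, so it lies on the geodesic to `w`, at most `2 * M + 1` from `w`. The route
`v`, `p`, `q`, `w` has length at most `(M + 1) + M + (2 * M + 1)`. -/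
theorem dist_le_of_outerSetoid (hG : G.Connected) {M : ℕ}
    (hM : ∀ {v : V} {γ : G.Walk o v}, γ.length = G.dist o v → ∀ {k}, k < γ.length →
      ∀ β : G.Walk v o, ∃ q ∈ β.support, G.dist q (γ.getVert k) ≤ M)
    {v w : V} (h : outerSetoid G o v w) : G.dist v w ≤ 4 * M + 2 := by
  obtain ⟨hd, β, hβ⟩ := h
  obtain ⟨γ, hγ⟩ := hG.exists_walk_length_eq_dist o v
  obtain ⟨δ, hδ⟩ := hG.exists_walk_length_eq_dist o w
  have ho := hG.dist_triangle (u := v) (v := o) (w := w)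
  rw [G.dist_comm (u := v) (v := o)] at ho
  by_cases hn : G.dist o v ≤ M
  · omega
  have hk : G.dist o v - (M + 1) < γ.length := by omega
  obtain ⟨q, hq, hqp⟩ := hM hγ hk (β.append δ.reverse)
  have h₁ := dist_getVert_of_length_eq_dist hG hγ hk.le
  have h₂ := dist_getVert_le hG γ (G.dist o v - (M + 1)) (M + 1)
  rw [Nat.sub_add_cancel (by omega), ← hγ, SimpleGraph.Walk.getVert_length, hγ] at h₂
  set p := γ.getVert (G.dist o v - (M + 1))
  have h₃ := hG.dist_triangle (u := o) (v := p) (w := q)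
  have h₄ := hG.dist_triangle (u := o) (v := q) (w := p)
  rw [G.dist_comm (u := p) (v := q)] at h₃
  rw [SimpleGraph.Walk.mem_support_append_iff] at hq
  rcases hq with hq | hq
  · have := hβ q hq
    omega
  · rw [SimpleGraph.Walk.support_reverse, List.mem_reverse] at hq
    obtain ⟨i, hi, hin⟩ := SimpleGraph.Walk.mem_support_iff_exists_getVert.mp hq
    have h₅ := dist_getVert_of_length_eq_dist hG hδ hin
    have h₆ := dist_getVert_le hG δ i (δ.length - i)
    rw [Nat.add_sub_cancel' hin, SimpleGraph.Walk.getVert_length] at h₆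
    rw [hi] at h₅ h₆
    have h₇ := hG.dist_triangle (u := v) (v := p) (w := w)
    have h₈ := hG.dist_triangle (u := p) (v := q) (w := w)
    rw [G.dist_comm (u := v) (v := p)] at h₇
    rw [G.dist_comm (u := p) (v := q)] at h₈
    omega

/-- Distances in `G` are controlled by distances in `H` along `g` if they are so for edges. -/
theorem dist_map_le {W : Type*} {H : SimpleGraph W} (hH : H.Connected) (hG : G.Connected)
    {g : W → V} {C : ℕ} (hg : ∀ a b, H.Adj a b → G.dist (g a) (g b) ≤ C) (a b : W) :
    G.dist (g a) (g b) ≤ C * H.dist a b := by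
  obtain ⟨w, hw⟩ := hH.exists_walk_length_eq_dist a b
  rw [← hw]
  clear hw
  induction w with
  | nil => simp
  | @cons a b c h w ih =>
    have h₁ := hg a b h
    have h₂ := hG.dist_triangle (u := g a) (v := g b) (w := g c)
    rw [SimpleGraph.Walk.length_cons, mul_add, mul_one]
    omega

theorem exists_tree_of_outerSetoid_bounded {V : Type u} {G : SimpleGraph V} {o : V}
    (hG : G.Connected) {C : ℕ} (hC : ∀ v w, outerSetoid G o v w → G.dist v w ≤ C) :
    ∃ (W : Type u) (T : SimpleGraph W) (_ : T.IsTree) (f : V → W) (g : W → V),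
      (∀ u v, T.dist (f u) (f v) ≤ G.dist u v) ∧
      (∀ a b, G.dist (g a) (g b) ≤ (C + 1) * T.dist a b) ∧
      (∀ v, G.dist (g (f v)) v ≤ C) ∧ ∀ a, f (g a) = a := by
  classical
  -- The value `o` at level 0 makes the root class its own parent.
  have hex : ∀ v, ∃ u, (G.dist o v ≠ 0 → G.Adj v u ∧ G.dist o u + 1 = G.dist o v) ∧
      (G.dist o v = 0 → u = o) := by
    intro v
    by_cases hv : G.dist o v = 0
    · exact ⟨o, by simp [hv]⟩
    · obtain ⟨u, hu⟩ := exists_adj_lower hG hv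
      exact ⟨u, fun _ => hu, fun h => (hv h).elim⟩
  choose lower hlower hlower0 using hex
  let W := Quotient (outerSetoid G o)
  let f : V → W := Quotient.mk _
  let g : W → V := Quotient.out
  have hfg : ∀ a, f (g a) = a := Quotient.out_eq
  have hgf : ∀ v, outerSetoid G o (g (f v)) v := fun v => Quotient.mk_out v
  let level : W → ℕ := fun a => G.dist o (g a)
  have hlevel : ∀ v, level (f v) = G.dist o v := fun v => (hgf v).1
  let parent : W → W := fun a => f (lower (g a))
  have hpar : ∀ u v, G.Adj u v → G.dist o v + 1 = G.dist o u → parent (f u) = f v := by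
    intro u v huv hd
    have h := hlower (g (f u)) (by rw [(hgf u).1]; omega)
    exact Quotient.sound (outerSetoid_of_adj_lower (hgf u) h.1 huv h.2 hd)
  have htree : (parentGraph parent).IsTree := by
    refine parentGraph_isTree (level := level) (root := f o) ?_ ?_ ?_
    · intro a ha
      change level (f _) + 1 = _
      rw [hlevel]
      exact (hlower _ ha).2
    · intro a ha
      rw [← hfg a, ← hG.dist_eq_zero_iff.mp ha]
    · have : G.dist o (g (f o)) = 0 := by rw [(hgf o).1, SimpleGraph.dist_self]
      change f _ = f o
      rw [hlower0 _ this]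
  refine ⟨W, parentGraph parent, htree, f, g, fun u v => ?_, fun a b => ?_,
    fun v => hC _ _ (hgf v), hfg⟩
  -- Levels of adjacent vertices differ by at most one, so an edge either collapses or becomes a
  -- parent edge.
  · have hstep : ∀ u v, G.Adj u v → (parentGraph parent).dist (f u) (f v) ≤ 1 := by
      intro u v huv
      by_cases he : f u = f v
      · simp [he]
      refine (SimpleGraph.dist_eq_one_iff_adj.mpr ?_).le
      rw [parentGraph_adj]
      refine ⟨he, ?_⟩
      have h₁ := hG.dist_triangle (u := o) (v := u) (w := v)
      have h₂ := hG.dist_triangle (u := o) (v := v) (w := u)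
      rw [SimpleGraph.dist_eq_one_iff_adj.mpr huv] at h₁
      rw [SimpleGraph.dist_eq_one_iff_adj.mpr huv.symm] at h₂
      rcases lt_trichotomy (G.dist o u) (G.dist o v) with h | h | h
      · exact Or.inr (hpar v u huv.symm (by omega))
      · exact (he (Quotient.sound (outerSetoid_of_adj huv h))).elim
      · exact Or.inl (hpar u v huv (by omega))
    simpa using dist_map_le hG htree.connected hstep u v
  · refine dist_map_le htree.connected hG ?_ a b
    -- One edge leads from `g a` to its lower neighbour, and at most `C` more to the chosen
    -- representative of that class.
    have key : ∀ a, a ≠ parent a → G.dist (g a) (g (parent a)) ≤ C + 1 := by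
      intro a ha
      have h0 : G.dist o (g a) ≠ 0 := by
        intro h
        apply ha
        change a = f _
        rw [hlower0 _ h, ← hfg a, ← hG.dist_eq_zero_iff.mp h]
      have h₁ := hG.dist_triangle (u := g a) (v := lower (g a)) (w := g (parent a))
      have h₂ := hC _ _ (hgf (lower (g a)))
      rw [SimpleGraph.dist_eq_one_iff_adj.mpr (hlower _ h0).1,
        G.dist_comm (u := lower (g a))] at h₁
      change G.dist (g (parent a)) (lower (g a)) ≤ C at h₂
      omega
    intro a b hab
    rw [parentGraph_adj] at hab
    obtain ⟨hne, rfl | rfl⟩ := hab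
    · exact key a hne
    · rw [SimpleGraph.dist_comm]
      exact key b hne.symm

end OuterComponents

/-! ### Assembling the quasi-isometry -/

theorem quasiIsometric_of_coarse_section {X Y : Type*} [MetricSpace X] [MetricSpace Y]
    (f : X → Y) (g : Y → X) {C : ℝ} (hC : 0 ≤ C)
    (hf : ∀ x x', dist (f x) (f x') ≤ dist x x')
    (hg : ∀ y y', dist (g y) (g y') ≤ (C + 1) * dist y y')
    (hgf : ∀ x, dist (g (f x)) x ≤ C) (hfg : ∀ y, f (g y) = y) : QuasiIsometric X Y := by
  have hC1 : 0 < C + 1 := by linarith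
  refine ⟨f, g, ⟨(C + 1)⁻¹, -((C + 1)⁻¹ * (2 * C)), 1, 0, by positivity, zero_le_one,
    fun x x' => ⟨?_, by simpa using hf x x'⟩⟩, ⟨1, 0, C + 1, 0, one_pos, hC1.le,
    fun y y' => ⟨?_, by simpa using hg y y'⟩⟩, ⟨C, hC, hgf⟩, ⟨0, le_rfl, by simp [hfg]⟩⟩
  -- Each lower bound comes from the upper bound for the other map; here `g ∘ f` moves points by at
  -- most `C`.
  · have h₁ := dist_triangle4 x (g (f x)) (g (f x')) x'
    rw [dist_comm x (g (f x))] at h₁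
    have h₂ := hg (f x) (f x')
    have h₃ : dist x x' - 2 * C ≤ (C + 1) * dist (f x) (f x') := by
      linarith [hgf x, hgf x']
    calc (C + 1)⁻¹ * dist x x' + -((C + 1)⁻¹ * (2 * C))
        = (C + 1)⁻¹ * (dist x x' - 2 * C) := by ring
      _ ≤ (C + 1)⁻¹ * ((C + 1) * dist (f x) (f x')) := by gcongr
      _ = dist (f x) (f x') := by field_simp
  · have := hf (g y) (g y')
    rw [hfg, hfg] at this
    simpa using this

end FillingRadius

theorem proposition4p5 {A : Type v} [Ring A] [Nontrivial A]
    {V : Type u} (G : SimpleGraph V) (hG : G.Connected)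
    (hFRC : letI := graphMetric G hG; IsS1FRC A V)
    (hcyc : letI := graphMetric G hG
      ∃ r : ℝ, 0 < r ∧
        ∀ f : SphericalOneCycle (ripsComplex V 1), f.NullHomologous A (ripsComplex V r)) :
    ∃ (W : Type u) (T : SimpleGraph W) (hT : T.IsTree),
      letI := graphMetric G hG
      letI := graphMetric T hT.connected
      QuasiIsometric V W := by
  obtain ⟨o⟩ := hG.nonempty
  obtain ⟨R, hR1, hR⟩ := exists_hasWalkFillings hG hFRC hcyc
  obtain ⟨W, T, hT, f, g, hf, hg, hgf, hfg⟩ :=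
    exists_tree_of_outerSetoid_bounded (o := o) hG fun v w h =>
      dist_le_of_outerSetoid hG (hR.exists_dist_le hR1 hG) h
  refine ⟨W, T, hT, ?_⟩
  let := graphMetric G hG
  let := graphMetric T hT.connected
  -- The constant is the class diameter bound `4 * M + 2` at the bottleneck constant `M = 2 * R`.
  refine quasiIsometric_of_coarse_section f g (C := (4 * (2 * R) + 2 : ℕ)) (Nat.cast_nonneg _)
    (fun x x' => Nat.cast_le.mpr (hf x x')) (fun y y' => ?_)
    (fun x => Nat.cast_le.mpr (hgf x)) hfg
  change (G.dist (g y) (g y') : ℝ) ≤ _ * (T.dist y y' : ℝ)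
  exact_mod_cast hg y y'
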